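/- Write $\overline{\mathbb R}=\mathbb R\cup\{\pm\infty\}$ and let $X$ be a finite set of variables; assignments $\rho:X\to\overline{\mathbb R}$ are ordered pointwise. **Morcave functions.** For $f:\overline{\mathbb R}^n\to\overline{\mathbb R}$ put $\mathrm{fdom}(f)=\{x\in\mathbb R^n : f(x)\in\mathbb R\}$. For $I:\{1,\dots,n\}\to\{-\infty,\mathrm{id},\infty\}$, where $\pm\infty$ denote the constant maps, put $f^{(I)}(x)=f(I(1)(x_1),\dots,I(n)(x_n))$. The function $f$ is *order-concave* if for every $I$: (1) $\mathrm{fdom}(f^{(I)})$ contains $\lambda x+(1-\lambda)y$ for all of its comparable points $x,y$ and all $\lambda\in[0,1]$; (2) for these, $f^{(I)}(\lambda x+(1-\lambda)y)\ge\lambda f^{(I)}(x)+(1-\lambda)f^{(I)}(y)$; (3) if $\mathrm{fdom}(f^{(I)})\ne\emptyset$, then $f^{(I)}(x)<\infty$ for all $x\in\mathbb R^n$. It is *morcave* if it is monotone and order-concave. **Systems and strategies.** Expressions are built from variables by applying operators on $\overline{\mathbb R}$ (constants included) and finite maxima $e_1\vee\dots\vee e_k$, $k\ge1$; $[\![e]\!]\rho$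 is the value of $e$ under $\rho$. A system $\mathcal E$ has one equation $x=e_x$ for each $x\in X$; put $([\![\mathcal E]\!]\rho)(x)=[\![e_x]\!]\rho$. A solution (pre-solution) of $\mathcal E$ is a $\rho$ with $\rho=[\![\mathcal E]\!]\rho$ ($\rho\le[\![\mathcal E]\!]\rho$). The system is a *system of $\vee$-morcave equations in standard form* if every $e_x$ is of the form $-\infty\vee e_1\vee\dots\vee e_k$ with all $[\![e_i]\!]$ morcave. A *$\vee$-strategy* $\sigma$ maps every expression $e_1\vee\dots\vee e_k$ occurring in $\mathcal E$ to one of its immediate sub-expressions $e_j$; $\mathrm{MaxStrat}$ is the set of all $\vee$-strategies, and $\mathcal E(\sigma)=\{x=\sigma(e_x) : x\in X\}$. If $\rho$ is a pre-solution of $\mathcal E(\sigma)$, then $\sigma'$ is an *improvement of $\sigma$ w.r.t. $\rho$* if (1) $[\![\mathcal E(\sigma')]\!]\rho>\rho$ unless $\rho$ is a solution of $\mathcal E$, and (2) $[\![\sigma'(e)]\!]\rho>[\![\sigma(e)]\!]\rho$ whenever $\sigma'(e)\ne\sigma(e)$. A *$\vee$-strategy improvement operator* $P$ assigns to every pair $(\sigma,\rho)$,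 $\rho$ a pre-solution of $\mathcal E(\sigma)$, an improvement of $\sigma$ w.r.t. $\rho$. **Algorithm** (with parameter $P$). Start with $\rho\equiv-\infty$ and a $\vee$-strategy $\sigma$ with $\mathcal E(\sigma)=\{x=-\infty : x\in X\}$. While $\rho$ is not a solution of $\mathcal E$, perform a strategy-improvement step: replace $\sigma$ by $P(\sigma,\rho)$, then replace $\rho$ by the least solution of $\mathcal E(\sigma)$ (for the new $\sigma$) that is $\ge\rho$. Finally return $\rho$. **Theorem.** Let $\mathcal E$ be a system of $\vee$-morcave equations in standard form. For every $\vee$-strategy improvement operator and every such initial strategy, the algorithm terminates and returns the least solution $\mu[\![\mathcal E]\!]$ of $\mathcal E$ (in particular, the least solutions called for in its steps exist). It performs at most $|X|\cdot|\mathrm{MaxStrat}|$ strategy-improvement steps. -/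

import Mathlib

/-! ### Order-concave functions on the extended reals -/

/-- A set of real vectors is order-convex if it contains the segment between any two of its
comparable points. -/
def IsOrderConvexSet {ι : Type*} (S : Set (ι → ℝ)) : Prop :=
  ∀ x ∈ S, ∀ y ∈ S, (x ≤ y ∨ y ≤ x) → ∀ t : ℝ, 0 ≤ t → t ≤ 1 → t • x + (1 - t) • y ∈ S

/-- The partial function with domain `S` and values `g` is order-concave: its domain is
order-convex, and the concavity inequality holds for comparable points of the domain. -/
def IsOrderConcaveOn {ι : Type*} (S : Set (ι → ℝ)) (g : (ι → ℝ) → ℝ) : Prop :=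
  IsOrderConvexSet S ∧
    ∀ x ∈ S, ∀ y ∈ S, (x ≤ y ∨ y ≤ x) → ∀ t : ℝ, 0 ≤ t → t ≤ 1 →
      t * g x + (1 - t) * g y ≤ g (t • x + (1 - t) • y)

/-- The three unary maps on the extended reals that may be applied to a coordinate: the constant
`-∞`, the identity, the constant `∞`. -/
inductive CoordMap where
  | negInf
  | ident
  | posInf

/-- The unary map on the extended reals named by a `CoordMap`. -/
noncomputable def CoordMap.toFun : CoordMap → EReal → EReal
  | .negInf, _ => ⊥
  | .ident, a => a
  | .posInf, _ => ⊤

/-- `f^(I)`: the function `f` after applying the map `I i` to the `i`-th coordinate. -/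
noncomputable def coordModify {ι : Type*} (f : (ι → EReal) → EReal) (I : ι → CoordMap) :
    (ι → EReal) → EReal :=
  fun x => f (fun i => (I i).toFun (x i))

/-- A real vector, seen as a vector of extended reals. -/
def realVec {ι : Type*} (x : ι → ℝ) : ι → EReal := fun i => (x i : EReal)

/-- The finite domain of `f`: the real vectors at which `f` has a real value. -/
def finDom {ι : Type*} (f : (ι → EReal) → EReal) : Set (ι → ℝ) :=
  {x | f (realVec x) ≠ ⊥ ∧ f (realVec x) ≠ ⊤}

/-- Order-concavity of a function on vectors of extended reals. -/
def IsOrderConcave {ι : Type*} (f : (ι → EReal) → EReal) : Prop :=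
  ∀ I : ι → CoordMap,
    IsOrderConcaveOn (finDom (coordModify f I))
      (fun x => (coordModify f I (realVec x)).toReal) ∧
    ((finDom (coordModify f I)).Nonempty → ∀ x : ι → ℝ, coordModify f I (realVec x) < ⊤)

/-- Morcave: monotone and order-concave. -/
def IsMorcave {ι : Type*} (f : (ι → EReal) → EReal) : Prop :=
  Monotone f ∧ IsOrderConcave f

/-! ### Expressions and systems of equations -/

/-- Expressions over the extended reals with variables in `X`: variables, applications of
arbitrary `k`-ary operators (constants for `k = 0`), and maxima `e₀ ∨ ⋯ ∨ e_k`. -/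
inductive FixExpr (X : Type*) where
  | var (x : X) : FixExpr X
  | app (k : ℕ) (f : (Fin k → EReal) → EReal) (args : Fin k → FixExpr X) : FixExpr X
  | max (k : ℕ) (args : Fin (k + 1) → FixExpr X) : FixExpr X

namespace FixExpr

variable {X : Type*}

/-- The value of an expression under a variable assignment. -/
noncomputable def eval (ρ : X → EReal) : FixExpr X → EReal
  | var x => ρ x
  | app _ f args => f (fun i => (args i).eval ρ)
  | max _ args => ⨆ i, (args i).eval ρ

/-- The constant `-∞`, as an expression. -/
noncomputable def negInf : FixExpr X := app 0 (fun _ => ⊥) (fun i => i.elim0)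

/-- The expression is of the form `e₀ ∨ ⋯ ∨ e_k`. -/
def IsMaxExpr : FixExpr X → Prop
  | max _ _ => True
  | _ => False

/-- The immediate sub-expressions `e₀, …, e_k` of an expression `e₀ ∨ ⋯ ∨ e_k`. -/
def maxArgs : FixExpr X → Set (FixExpr X)
  | max _ args => Set.range args
  | _ => ∅

/-- The set of all expressions that occur in an expression, itself included. -/
def subs : FixExpr X → Set (FixExpr X)
  | var x => {var x}
  | app k f args => insert (app k f args) (⋃ i, (args i).subs)
  | max k args => insert (max k args) (⋃ i, (args i).subs)

theorem subs_finite (e : FixExpr X) : e.subs.Finite := by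
  induction e with
  | var x => exact Set.finite_singleton _
  | app k f args ih => exact (Set.finite_iUnion ih).insert _
  | max k args ih => exact (Set.finite_iUnion ih).insert _

theorem maxArgs_finite (e : FixExpr X) : e.maxArgs.Finite := by
  cases e with
  | var x => exact Set.finite_empty
  | app k f args => exact Set.finite_empty
  | max k args => exact Set.finite_range _

/-- `e = e₀ ∨ ⋯ ∨ e_k` where every `e_i` denotes a morcave function. -/
def IsMaxMorcave (e : FixExpr X) : Prop :=
  e.IsMaxExpr ∧ ∀ e' ∈ e.maxArgs, IsMorcave (fun ρ => e'.eval ρ)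

/-- `e = -∞ ∨ e₁ ∨ ⋯ ∨ e_k`. -/
def IsStandard : FixExpr X → Prop
  | max _ args => args 0 = negInf
  | _ => False

end FixExpr

/-- A system of fixpoint equations `x = E x`, one for each variable `x`. -/
def EqSystem (X : Type*) := X → FixExpr X

namespace EqSystem

variable {X : Type*}

/-- The operator on variable assignments that is given by the right-hand sides. -/
noncomputable def op (E : EqSystem X) (ρ : X → EReal) : X → EReal := fun x => (E x).eval ρ

/-- The set of solutions of `E`, i.e. of the fixpoints of its operator. -/
def sol (E : EqSystem X) : Set (X → EReal) := {ρ | ρ = E.op ρ}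

/-- The set of pre-solutions of `E`. -/
def preSol (E : EqSystem X) : Set (X → EReal) := {ρ | ρ ≤ E.op ρ}

/-- All right-hand sides are maxima of morcave expressions. -/
def IsMaxMorcave (E : EqSystem X) : Prop := ∀ x, (E x).IsMaxMorcave

/-- Every equation is of the form `x = -∞ ∨ e₁ ∨ ⋯ ∨ e_k`. -/
def IsStandard (E : EqSystem X) : Prop := ∀ x, (E x).IsStandard

/-- The set of all expressions of the form `e₀ ∨ ⋯ ∨ e_k` that occur in `E`. -/
def maxExprs (E : EqSystem X) : Set (FixExpr X) := {e | e.IsMaxExpr ∧ ∃ x, e ∈ (E x).subs}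

/-- A `∨`-strategy for `E` maps every expression `e₀ ∨ ⋯ ∨ e_k` occurring in `E` to one of its
immediate sub-expressions. -/
def MaxStrat (E : EqSystem X) := (e : E.maxExprs) → (e : FixExpr X).maxArgs

instance instFiniteMaxStrat [Finite X] (E : EqSystem X) : Finite E.MaxStrat := by
  have h1 : Finite E.maxExprs :=
    ((Set.finite_iUnion fun x => (E x).subs_finite).subset
      (fun e he => Set.mem_iUnion.2 he.2)).to_subtype
  have h2 : ∀ e : E.maxExprs, Finite (e : FixExpr X).maxArgs :=
    fun e => (FixExpr.maxArgs_finite _).to_subtype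
  exact Pi.finite

open Classical in
/-- The system `E(σ)`, in which every right-hand side `e` is replaced by `σ(e)`. (A right-hand side
that is not a maximum is kept.) -/
noncomputable def applyStrat (E : EqSystem X) (σ : E.MaxStrat) : EqSystem X :=
  fun x => if h : E x ∈ E.maxExprs then (σ ⟨E x, h⟩ : FixExpr X) else E x

/-- The strategy `σ'` is an improvement of `σ` with respect to `ρ`. -/
def IsImprovement (E : EqSystem X) (σ σ' : E.MaxStrat) (ρ : X → EReal) : Prop :=
  (ρ ∉ E.sol → ρ < (E.applyStrat σ').op ρ) ∧
    ∀ e : E.maxExprs, σ' e ≠ σ e →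
      (σ e : FixExpr X).eval ρ < (σ' e : FixExpr X).eval ρ

/-- A `∨`-strategy improvement operator assigns an improvement of `σ` with respect to `ρ` to every
pair of a strategy `σ` and a pre-solution `ρ` of `E(σ)`. (Its values at other pairs are
irrelevant.) -/
def IsImprovementOperator (E : EqSystem X) (P : E.MaxStrat → (X → EReal) → E.MaxStrat) : Prop :=
  ∀ (σ : E.MaxStrat) (ρ : X → EReal), ρ ∈ (E.applyStrat σ).preSol →
    E.IsImprovement σ (P σ ρ) ρ

/-- `E.Run P σ₀ ρ₀ n σ ρ`: the `∨`-strategy improvement algorithm with improvement operator `P`,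
started with `σ₀` and `ρ₀`, evaluates its loop body at least `n` times, and `σ` and `ρ` are the
values of its program variables after the `n`-th evaluation. The loop is

  `while ρ ∉ Sol(E) do  σ ← P(σ, ρ);  ρ ← the least solution of E(σ) that is ≥ ρ`. -/
inductive Run (E : EqSystem X) (P : E.MaxStrat → (X → EReal) → E.MaxStrat)
    (σ₀ : E.MaxStrat) (ρ₀ : X → EReal) : ℕ → E.MaxStrat → (X → EReal) → Prop
  | init : Run E P σ₀ ρ₀ 0 σ₀ ρ₀
  | step {n : ℕ} {σ : E.MaxStrat} {ρ ρ' : X → EReal} (hrun : Run E P σ₀ ρ₀ n σ ρ)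
      (hguard : ρ ∉ E.sol)
      (hleast : IsLeast {η | η ∈ (E.applyStrat (P σ ρ)).sol ∧ ρ ≤ η} ρ') :
      Run E P σ₀ ρ₀ (n + 1) (P σ ρ) ρ'

/-- The algorithm terminates after exactly `n` evaluations of its loop body and returns `ρ`. -/
def Returns (E : EqSystem X) (P : E.MaxStrat → (X → EReal) → E.MaxStrat)
    (σ₀ : E.MaxStrat) (ρ₀ : X → EReal) (n : ℕ) (ρ : X → EReal) : Prop :=
  ∃ σ, E.Run P σ₀ ρ₀ n σ ρ ∧ ρ ∈ E.sol

end EqSystem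

/-!
Every iterate `ρ` of the algorithm stays below the least solution of `E`, because a solution of `E`
is a post-solution of every `E(σ)`; so the algorithm is correct as soon as it stops, and the whole
content is the bound on the number of steps.

Each iterate is a *feasible* solution of the current system `E(σ)` (`IsFeasible`): it is the least
post-solution above some `z` that lies strictly below `ρ` wherever `ρ` is not `-∞`. Feasibility is
preserved by improvement steps for order-theoretic reasons alone (`IsFeasible.improve`): in the
coordinates whose equation changes, `z` may be replaced by the old value of `ρ`, since the new value
is strictly larger. Order-concavity then shows that a feasible solution dominates every
pre-solution that lies above it and has the same infinite coordinates (`IsFeasible.le_of_le`): a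
larger pre-solution `η` would allow the pre-image of `ρ` under `v ↦ t v + (1 - t) η`, with `t` close
to `1`, to be used as a post-solution above `z` that is not above `ρ`.

For the count, a strategy determines the set of coordinates at which the iterate is `-∞`: these are
the ones whose current right-hand side is the constant `-∞` (`StepInvariant.negInf`). The iterates
increase strictly, so two of them with the same strategy differ in the number of their coordinates
equal to `∞`. An iterate other than `⊤` is therefore determined among the iterates by this number,
which is less than `|X|`, and its strategy; the single iterate that may be equal to `⊤` can be given
the pair of `0` and the initial strategy, which no iterate after the first one has.
-/

/-! ### Least solutions and feasible solutions -/

/-- Above a pre-fixpoint of a monotone operator there is a least fixpoint, and it is even the least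
post-fixpoint there. -/
theorem exists_least_fixpoint_above {α : Type*} [CompleteLattice α] {f : α → α} (hf : Monotone f)
    {ρ : α} (hρ : ρ ≤ f ρ) :
    ∃ m, f m = m ∧ ρ ≤ m ∧ ∀ u, ρ ≤ u → f u ≤ u → m ≤ u := by
  let F : α →o α := ⟨fun u => ρ ⊔ f u, fun a b h => sup_le_sup_left (hf h) ρ⟩
  have hm : ρ ⊔ f F.lfp = F.lfp := F.map_lfp
  have h1 : ρ ≤ F.lfp := le_sup_left.trans hm.le
  have h2 : f F.lfp = F.lfp := by
    rw [sup_eq_right.2 (hρ.trans (hf h1))] at hm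
    exact hm
  exact ⟨F.lfp, h2, h1, fun u hu hfu => F.lfp_le (sup_le hu hfu)⟩

/-- A fixpoint `ρ` of `f` is feasible if it is the least post-fixpoint of `f` above some `z` that is
strictly smaller than `ρ` in every coordinate where `ρ` is not `-∞`. -/
def IsFeasible {X : Type*} (f : (X → EReal) → (X → EReal)) (ρ : X → EReal) : Prop :=
  f ρ = ρ ∧ ∃ z ≤ ρ, (∀ x, ρ x ≠ ⊥ → z x < ρ x) ∧ ∀ u, z ≤ u → f u ≤ u → ρ ≤ u

/-- If `g` differs from `f` only in coordinates where it improves the feasible fixpoint `ρ` of `f`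
strictly, then the least fixpoint of `g` above `ρ` is feasible. -/
theorem IsFeasible.improve {X : Type*} {f g : (X → EReal) → (X → EReal)} {ρ m : X → EReal}
    (hρ : IsFeasible f ρ) (hf : Monotone f) (hg : Monotone g)
    (hfg : ∀ x, (∀ u, g u x = f u x) ∨ ρ x < g ρ x)
    (hm : g m = m) (hρm : ρ ≤ m) (hleast : ∀ u, ρ ≤ u → g u ≤ u → m ≤ u) :
    IsFeasible g m := by
  classical
  obtain ⟨hfix, z, hzρ, hlt, hz⟩ := hρ
  refine ⟨hm, fun x => if ∀ u, g u x = f u x then z x else ρ x, fun x => ?_, fun x hx => ?_,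
    fun u hu hgu => hleast u ?_ hgu⟩
  · dsimp only
    split_ifs
    · exact (hzρ x).trans (hρm x)
    · exact hρm x
  · dsimp only
    split_ifs with h
    · by_cases hb : ρ x = ⊥
      · have h1 : z x = ⊥ := le_bot_iff.1 (hb ▸ hzρ x)
        rw [h1]
        exact bot_lt_iff_ne_bot.2 hx
      · exact (hlt x hb).trans_le (hρm x)
    · exact ((hfg x).resolve_left h).trans_le ((hg hρm x).trans_eq (congrFun hm x))
  · -- The infimum of `u` and `ρ` is a post-fixpoint of the old operator `f` above `z`.
    have hv : ρ ≤ u ⊓ ρ := by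
      refine hz _ (le_inf (fun x => ?_) hzρ) fun x => le_inf ?_ ?_
      · have := hu x
        dsimp only at this
        split_ifs at this
        · exact this
        · exact (hzρ x).trans this
      · by_cases h : ∀ u, g u x = f u x
        · calc f (u ⊓ ρ) x ≤ f u x := hf inf_le_left x
            _ = g u x := (h u).symm
            _ ≤ u x := hgu x
        · have hux := hu x
          simp only [if_neg h] at hux
          exact ((hf inf_le_right x).trans_eq (congrFun hfix x)).trans hux
      · exact (hf inf_le_right x).trans_eq (congrFun hfix x)
    exact hv.trans inf_le_left

/-! ### Maximality of feasible solutions of morcave systems -/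

theorem CoordMap.toFun_mono (c : CoordMap) {a b : EReal} (h : a ≤ b) : c.toFun a ≤ c.toFun b := by
  cases c
  · exact le_rfl
  · exact h
  · exact le_rfl

/-- A point that is strictly below `r` can be moved slightly towards any other point without leaving
the region below `r`. -/
theorem exists_combination_le {X : Type*} [Finite X] {c r : X → ℝ} (hc : ∀ x, c x < r x)
    (d : X → ℝ) : ∃ t : ℝ, 0 < t ∧ t < 1 ∧ ∀ x, t * c x + (1 - t) * d x ≤ r x := by
  have h1 : ∀ᶠ t in nhdsWithin (1 : ℝ) (Set.Iio 1), ∀ x, t * c x + (1 - t) * d x < r x := by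
    rw [Filter.eventually_all]
    intro x
    have hcont : ContinuousAt (fun t : ℝ => t * c x + (1 - t) * d x) 1 := by fun_prop
    refine nhdsWithin_le_nhds (hcont.eventually_lt continuousAt_const ?_)
    simpa using hc x
  have h2 : ∀ᶠ t in nhdsWithin (1 : ℝ) (Set.Iio 1), 0 < t :=
    nhdsWithin_le_nhds (lt_mem_nhds one_pos)
  obtain ⟨t, ⟨ht, ht0⟩, ht1⟩ := ((h1.and h2).and self_mem_nhdsWithin).exists
  exact ⟨t, ht0, ht1, fun x => (ht x).le⟩

/-- A feasible fixpoint of a morcave operator is the greatest among the pre-fixpoints that lie above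
it and are `-∞` and `∞` at the same coordinates. -/
theorem IsFeasible.le_of_le {X : Type*} [Finite X] {f : (X → EReal) → (X → EReal)}
    {ρ η : X → EReal} (hρ : IsFeasible f ρ) (hf : ∀ x, IsMorcave fun u => f u x)
    (hρη : ρ ≤ η) (hη : η ≤ f η)
    (hbot : ∀ x, ρ x = ⊥ → η x = ⊥) (htop : ∀ x, η x = ⊤ → ρ x = ⊤) : η ≤ ρ := by
  classical
  obtain ⟨hfix, z, hzρ, hlt, hz⟩ := hρ
  have hmono : Monotone f := fun a b h x => (hf x).1 h
  let I : X → CoordMap := fun x =>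
    if ρ x = ⊥ then .negInf else if ρ x = ⊤ then .posInf else .ident
  -- `emb a` has the infinite coordinates of `ρ` and the values of `a` at the others.
  let emb : (X → ℝ) → X → EReal := fun a x => (I x).toFun (a x)
  have emb_bot : ∀ a x, ρ x = ⊥ → emb a x = ⊥ := fun a x h => by simp [emb, I, h, CoordMap.toFun]
  have emb_top : ∀ a x, ρ x = ⊤ → emb a x = ⊤ := fun a x h => by simp [emb, I, h, CoordMap.toFun]
  have emb_fin : ∀ a x, ρ x ≠ ⊥ → ρ x ≠ ⊤ → emb a x = a x :=
    fun a x h h' => by simp [emb, I, h, h', CoordMap.toFun]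
  have emb_mono : ∀ a b : X → ℝ, a ≤ b → emb a ≤ emb b :=
    fun a b h x => (I x).toFun_mono (EReal.coe_le_coe_iff.2 (h x))
  have hηbot : ∀ x, ρ x ≠ ⊥ → η x ≠ ⊥ := fun x h h' => h (le_bot_iff.1 (h' ▸ hρη x))
  have hηtop : ∀ x, ρ x ≠ ⊤ → η x ≠ ⊤ := fun x h h' => h (htop x h')
  let r : X → ℝ := fun x => (ρ x).toReal
  let s : X → ℝ := fun x => (η x).toReal
  have hr : emb r = ρ := by
    funext x
    by_cases h1 : ρ x = ⊥
    · rw [emb_bot _ _ h1, h1]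
    by_cases h2 : ρ x = ⊤
    · rw [emb_top _ _ h2, h2]
    rw [emb_fin _ _ h1 h2, EReal.coe_toReal h2 h1]
  have hs : emb s = η := by
    funext x
    by_cases h1 : ρ x = ⊥
    · rw [emb_bot _ _ h1, hbot x h1]
    by_cases h2 : ρ x = ⊤
    · have hη2 : η x = ⊤ := top_le_iff.1 (h2 ▸ hρη x)
      rw [emb_top _ _ h2, hη2]
    rw [emb_fin _ _ h1 h2, EReal.coe_toReal (hηtop x h2) (hηbot x h1)]
  have hrs : r ≤ s := by
    intro x
    by_cases h1 : ρ x = ⊥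
    · simp [r, s, h1, hbot x h1]
    by_cases h2 : ρ x = ⊤
    · simp [r, s, h2, top_le_iff.1 (h2 ▸ hρη x)]
    exact EReal.toReal_le_toReal (hρη x) h1 (hηtop x h2)
  -- Raising `z` to a real vector strictly below `r` keeps `ρ` the least post-fixpoint above it.
  have hc : ∀ x, ∃ c : ℝ, c < r x ∧ (ρ x ≠ ⊥ → ρ x ≠ ⊤ → z x ≤ c) := by
    intro x
    by_cases h1 : ρ x = ⊥
    · exact ⟨r x - 1, sub_one_lt _, fun h => absurd h1 h⟩
    by_cases h2 : ρ x = ⊤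
    · exact ⟨r x - 1, sub_one_lt _, fun _ h => absurd h2 h⟩
    obtain ⟨c, hzc, hcρ⟩ := EReal.lt_iff_exists_real_btwn.1 (hlt x h1)
    refine ⟨c, ?_, fun _ _ => hzc.le⟩
    rwa [← EReal.coe_toReal h2 h1, EReal.coe_lt_coe_iff] at hcρ
  choose c hcr hzc using hc
  obtain ⟨t, ht0, ht1, ht⟩ := exists_combination_le hcr s
  -- The pre-image of `r` under `v ↦ t v + (1 - t) s`, cut off at `r`.
  let v : X → ℝ := fun x => min (r x) ((r x - (1 - t) * s x) / t)
  have hvr : v ≤ r := fun x => min_le_left _ _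
  have hzv : z ≤ emb v := by
    intro x
    by_cases h1 : ρ x = ⊥
    · exact (hzρ x).trans (by simp [h1])
    by_cases h2 : ρ x = ⊤
    · simp [emb_top _ _ h2]
    rw [emb_fin _ _ h1 h2]
    refine (hzc x h1 h2).trans (EReal.coe_le_coe_iff.2 (le_min (hcr x).le ?_))
    rw [le_div_iff₀ ht0]
    linarith [ht x]
  have hcomb : t • v + (1 - t) • s ≤ r := by
    intro x
    have h := (le_div_iff₀ ht0).1 (min_le_right (r x) ((r x - (1 - t) * s x) / t))
    simp only [Pi.add_apply, Pi.smul_apply, smul_eq_mul]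
    change v x * t ≤ _ at h
    linarith
  have hfv : f (emb v) ≤ emb v := by
    intro x
    have hle : f (emb v) x ≤ ρ x := by
      have := hmono (emb_mono v r hvr) x
      rwa [hr, hfix] at this
    by_cases h1 : ρ x = ⊥
    · exact hle.trans (by simp [h1])
    by_cases h2 : ρ x = ⊤
    · simp [emb_top _ _ h2]
    by_cases h3 : f (emb v) x = ⊥
    · simp [h3]
    have h4 : f (emb v) x ≠ ⊤ := fun h => h2 (top_le_iff.1 (h ▸ hle))
    obtain ⟨⟨hconv, hconc⟩, hfin⟩ := (hf x).2 I
    have hvmem : v ∈ finDom (coordModify (fun u => f u x) I) := ⟨h3, h4⟩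
    have hηf : f (emb s) x ≠ ⊥ := by
      rw [hs]
      exact fun h => hηbot x h1 (le_bot_iff.1 (h ▸ hη x))
    have hηf' : f (emb s) x ≠ ⊤ := (hfin ⟨v, hvmem⟩ s).ne
    have hsmem : s ∈ finDom (coordModify (fun u => f u x) I) := ⟨hηf, hηf'⟩
    have hmem := hconv v hvmem s hsmem (.inl (hvr.trans hrs)) t ht0.le ht1.le
    have hineq : t * (f (emb v) x).toReal + (1 - t) * (f (emb s) x).toReal ≤
        (f (emb (t • v + (1 - t) • s)) x).toReal :=
      hconc v hvmem s hsmem (.inl (hvr.trans hrs)) t ht0.le ht1.le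
    have hup : (f (emb (t • v + (1 - t) • s)) x).toReal ≤ r x := by
      refine EReal.toReal_le_toReal ?_ hmem.1 h2
      have := hmono (emb_mono _ r hcomb) x
      rwa [hr, hfix] at this
    have hlow : s x ≤ (f (emb s) x).toReal := by
      refine EReal.toReal_le_toReal ?_ (hηbot x h1) hηf'
      rw [hs]
      exact hη x
    rw [emb_fin _ _ h1 h2, ← EReal.coe_toReal h4 h3, EReal.coe_le_coe_iff]
    refine le_min (EReal.toReal_le_toReal hle h3 h2) ((le_div_iff₀ ht0).2 ?_)
    have := mul_le_mul_of_nonneg_left hlow (sub_nonneg.2 ht1.le)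
    linarith
  have hρv := hz _ hzv hfv
  rw [← hr, ← hs]
  intro x
  by_cases h1 : ρ x = ⊥
  · rw [emb_bot _ _ h1, emb_bot _ _ h1]
  by_cases h2 : ρ x = ⊤
  · rw [emb_top _ _ h2, emb_top _ _ h2]
  have h := hρv x
  rw [← hr, emb_fin _ _ h1 h2, emb_fin _ _ h1 h2, EReal.coe_le_coe_iff] at h
  have h' := (le_div_iff₀ ht0).1 (h.trans (min_le_right _ _))
  rw [emb_fin _ _ h1 h2, emb_fin _ _ h1 h2, EReal.coe_le_coe_iff]
  have h3 : (1 - t) * s x ≤ (1 - t) * r x := by linarith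
  exact le_of_mul_le_mul_left h3 (sub_pos.2 ht1)

/-! ### Strategies and the operators of their systems -/

namespace EqSystem

variable {X : Type*} {E : EqSystem X}

theorem IsMaxMorcave.mem_maxExprs (hE : E.IsMaxMorcave) (x : X) : E x ∈ E.maxExprs := by
  refine ⟨(hE x).1, x, ?_⟩
  cases E x <;> simp [FixExpr.subs]

theorem IsMaxMorcave.applyStrat_apply (hE : E.IsMaxMorcave) (σ : E.MaxStrat) (x : X) :
    E.applyStrat σ x = (σ ⟨E x, hE.mem_maxExprs x⟩ : FixExpr X) :=
  dif_pos _

theorem IsMaxMorcave.applyStrat_mem (hE : E.IsMaxMorcave) (σ : E.MaxStrat) (x : X) :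
    E.applyStrat σ x ∈ (E x).maxArgs := by
  rw [hE.applyStrat_apply]
  exact (σ ⟨E x, hE.mem_maxExprs x⟩).2

theorem IsMaxMorcave.isMorcave_op (hE : E.IsMaxMorcave) (σ : E.MaxStrat) (x : X) :
    IsMorcave fun ρ => (E.applyStrat σ).op ρ x :=
  (hE x).2 _ (hE.applyStrat_mem σ x)

theorem IsMaxMorcave.monotone_op_applyStrat (hE : E.IsMaxMorcave) (σ : E.MaxStrat) :
    Monotone (E.applyStrat σ).op :=
  fun _ _ h x => (hE.isMorcave_op σ x).1 h

theorem _root_.FixExpr.eval_le_of_mem_maxArgs {e e' : FixExpr X} (h : e' ∈ e.maxArgs)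
    (ρ : X → EReal) : e'.eval ρ ≤ e.eval ρ := by
  cases e with
  | max k args =>
    obtain ⟨i, rfl⟩ := h
    exact le_iSup (fun i => (args i).eval ρ) i
  | _ => exact h.elim

theorem IsMaxMorcave.op_applyStrat_le (hE : E.IsMaxMorcave) (σ : E.MaxStrat) (ρ : X → EReal) :
    (E.applyStrat σ).op ρ ≤ E.op ρ :=
  fun x => FixExpr.eval_le_of_mem_maxArgs (hE.applyStrat_mem σ x) ρ

/-- A right-hand side that is changed by an improvement has a strictly larger value. -/
theorem IsImprovement.op_lt_of_ne (hE : E.IsMaxMorcave) {σ σ' : E.MaxStrat} {ρ : X → EReal}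
    (h : E.IsImprovement σ σ' ρ) {x : X} (hx : E.applyStrat σ' x ≠ E.applyStrat σ x) :
    (E.applyStrat σ).op ρ x < (E.applyStrat σ').op ρ x := by
  have hne : σ' ⟨E x, hE.mem_maxExprs x⟩ ≠ σ ⟨E x, hE.mem_maxExprs x⟩ := by
    intro h'
    rw [hE.applyStrat_apply, hE.applyStrat_apply, h'] at hx
    exact hx rfl
  have := h.2 _ hne
  rwa [← hE.applyStrat_apply, ← hE.applyStrat_apply] at this

/-! ### The invariant of the algorithm -/

/-- What holds for the program variables `σ` and `ρ` whenever the loop guard is evaluated. -/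
structure StepInvariant (E : EqSystem X) (σ : E.MaxStrat) (ρ : X → EReal) : Prop where
  feasible : IsFeasible (E.applyStrat σ).op ρ
  /-- The `-∞` coordinates of `ρ` can be read off from the strategy. -/
  negInf : ∀ x, ρ x = ⊥ ↔ E.applyStrat σ x = FixExpr.negInf
  le_sol : ∀ η ∈ E.sol, ρ ≤ η

theorem StepInvariant.mem_preSol {σ : E.MaxStrat} {ρ : X → EReal} (h : E.StepInvariant σ ρ) :
    ρ ∈ (E.applyStrat σ).preSol :=
  h.feasible.1.ge

theorem op_apply_of_eq_negInf {x : X} (h : E x = FixExpr.negInf) (ρ : X → EReal) :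
    E.op ρ x = ⊥ := by
  simp [op, h, FixExpr.negInf, FixExpr.eval]

theorem StepInvariant.init {σ : E.MaxStrat} (h : ∀ x, E.applyStrat σ x = FixExpr.negInf) :
    E.StepInvariant σ (fun _ => ⊥) where
  feasible := ⟨funext fun x => op_apply_of_eq_negInf (h x) _, ⊥, bot_le,
    fun _ hx => (hx rfl).elim, fun _ _ _ _ => bot_le⟩
  negInf x := ⟨fun _ => h x, fun _ => rfl⟩
  le_sol _ _ _ := bot_le

theorem exists_isLeast_sol (hE : E.IsMaxMorcave) {σ : E.MaxStrat} {ρ : X → EReal}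
    (h : ρ ≤ (E.applyStrat σ).op ρ) :
    ∃ m, IsLeast {η | η ∈ (E.applyStrat σ).sol ∧ ρ ≤ η} m ∧
      ∀ u, ρ ≤ u → (E.applyStrat σ).op u ≤ u → m ≤ u := by
  obtain ⟨m, hm, hρm, hleast⟩ := exists_least_fixpoint_above (hE.monotone_op_applyStrat σ) h
  exact ⟨m, ⟨⟨hm.symm, hρm⟩, fun u hu => hleast u hu.2 hu.1.ge⟩, hleast⟩

theorem StepInvariant.step (hE : E.IsMaxMorcave) {σ σ' : E.MaxStrat} {ρ ρ' : X → EReal}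
    (h : E.StepInvariant σ ρ) (himp : E.IsImprovement σ σ' ρ) (hguard : ρ ∉ E.sol)
    (hleast : IsLeast {η | η ∈ (E.applyStrat σ').sol ∧ ρ ≤ η} ρ') :
    E.StepInvariant σ' ρ' ∧ ρ < ρ' := by
  have hlt := himp.1 hguard
  obtain ⟨m, hm, hpost⟩ := exists_isLeast_sol hE hlt.le
  obtain rfl : ρ' = m := hleast.unique hm
  have hfix : (E.applyStrat σ').op ρ' = ρ' := hleast.1.1.symm
  have hle : ρ ≤ ρ' := hleast.1.2
  have hop : (E.applyStrat σ').op ρ ≤ ρ' :=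
    (hE.monotone_op_applyStrat σ' hle).trans_eq hfix
  have hchange : ∀ x, E.applyStrat σ' x = E.applyStrat σ x ∨ ρ x < (E.applyStrat σ').op ρ x := by
    intro x
    refine or_iff_not_imp_left.2 fun hne => ?_
    have := himp.op_lt_of_ne hE hne
    rwa [h.feasible.1] at this
  refine ⟨⟨?_, fun x => ⟨fun hx => ?_, fun hx => ?_⟩, fun η hη => ?_⟩, hlt.trans_le hop⟩
  · refine h.feasible.improve (hE.monotone_op_applyStrat σ) (hE.monotone_op_applyStrat σ')
      (fun x => (hchange x).imp_left fun he u => ?_) hfix hle hpost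
    simp only [op, he]
  · have hρx : ρ x = ⊥ := le_bot_iff.1 (hx ▸ hle x)
    rcases hchange x with he | hlt'
    · rw [he]
      exact (h.negInf x).1 hρx
    · exact absurd (hx ▸ hlt'.trans_le (hop x)) not_lt_bot
  · rw [← hfix]
    exact op_apply_of_eq_negInf hx _
  · exact hpost η (h.le_sol η hη) ((hE.op_applyStrat_le σ' η).trans_eq (Eq.symm hη))

/-! ### Counting the steps -/

open Classical in
/-- The pair that identifies an iterate among all iterates: the number of coordinates equal to `∞`
and the strategy. The iterate `⊤`, whose number `|X|` would be out of range, gets the otherwise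
unused pair of `0` and the initial strategy. -/
noncomputable def stepKey [Fintype X] (σinit σ : E.MaxStrat) (ρ : X → EReal) : ℕ × E.MaxStrat :=
  if ρ = ⊤ then (0, σinit) else ((Finset.univ.filter fun x => ρ x = ⊤).card, σ)

theorem stepKey_fst_lt [Fintype X] (σinit σ : E.MaxStrat) {ρ : X → EReal} (hρ : ρ ≠ ⊥) :
    (stepKey σinit σ ρ).1 < Fintype.card X := by
  classical
  unfold stepKey
  split_ifs with h
  · obtain ⟨x, -⟩ := Function.ne_iff.1 hρ
    exact Fintype.card_pos_iff.2 ⟨x⟩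
  · obtain ⟨x, hx⟩ := Function.ne_iff.1 h
    exact Finset.card_lt_univ_of_notMem (x := x) (by simpa using hx)

theorem stepKey_ne_of_lt [Fintype X] (hE : E.IsMaxMorcave) {σinit σ σ' : E.MaxStrat}
    (hinit : ∀ x, E.applyStrat σinit x = FixExpr.negInf) {ρ ρ' : X → EReal}
    (h : E.StepInvariant σ ρ) (h' : E.StepInvariant σ' ρ') (hρ : ρ ≠ ⊥) (hlt : ρ < ρ') :
    stepKey σinit σ ρ ≠ stepKey σinit σ' ρ' := by
  classical
  intro hkey
  unfold stepKey at hkey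
  rw [if_neg hlt.ne_top] at hkey
  split_ifs at hkey with htop
  · obtain rfl : σ = σinit := (Prod.ext_iff.1 hkey).2
    exact hρ (funext fun x => (h.negInf x).2 (hinit x))
  · obtain ⟨hcard, rfl⟩ : _ ∧ σ = σ' := Prod.ext_iff.1 hkey
    have hsub : (Finset.univ.filter fun x => ρ x = ⊤) ⊆ Finset.univ.filter fun x => ρ' x = ⊤ := by
      intro x hx
      simp only [Finset.mem_filter, Finset.mem_univ, true_and] at hx ⊢
      exact top_le_iff.1 (hx ▸ hlt.le x)
    have heq := Finset.eq_of_subset_of_card_le hsub hcard.ge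
    refine hlt.not_ge (h.feasible.le_of_le (hE.isMorcave_op σ) hlt.le h'.mem_preSol
      (fun x hx => (h'.negInf x).2 ((h.negInf x).1 hx)) fun x hx => ?_)
    have hx' : x ∈ Finset.univ.filter fun x => ρ' x = ⊤ := by simpa using hx
    rw [← heq] at hx'
    simpa using hx'

/-- Along a run, the invariant holds and the iterates after the first one have distinct keys. -/
theorem Run.invariant [Fintype X] (hE : E.IsMaxMorcave)
    {P : E.MaxStrat → (X → EReal) → E.MaxStrat} (hP : E.IsImprovementOperator P)
    {σinit : E.MaxStrat} (hinit : ∀ x, E.applyStrat σinit x = FixExpr.negInf)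
    {n : ℕ} {σ : E.MaxStrat} {ρ : X → EReal} (hrun : E.Run P σinit (fun _ => ⊥) n σ ρ) :
    E.StepInvariant σ ρ ∧ ∃ V : Finset (ℕ × E.MaxStrat), V.card = n ∧
      ∀ k ∈ V, ∃ τ η, E.StepInvariant τ η ∧ η ≠ ⊥ ∧ η ≤ ρ ∧ k = stepKey σinit τ η := by
  classical
  induction hrun with
  | init => exact ⟨.init hinit, ∅, rfl, by simp⟩
  | @step n σ ρ ρ' _ hguard hleast ih =>
    obtain ⟨hinv, V, hV, hkeys⟩ := ih
    obtain ⟨hinv', hlt⟩ := hinv.step hE (hP σ ρ hinv.mem_preSol) hguard hleast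
    refine ⟨hinv', insert (stepKey σinit (P σ ρ) ρ') V, ?_, fun k hk => ?_⟩
    · rw [Finset.card_insert_of_notMem, hV]
      intro hmem
      obtain ⟨τ, η, hη, hne, hle, hk⟩ := hkeys _ hmem
      exact stepKey_ne_of_lt hE hinit hη hinv' hne (hle.trans_lt hlt) hk.symm
    · rcases Finset.mem_insert.1 hk with rfl | hk
      · exact ⟨P σ ρ, ρ', hinv', (bot_le.trans_lt hlt).ne', le_rfl, rfl⟩
      · obtain ⟨τ, η, hη, hne, hle, hk⟩ := hkeys k hk
        exact ⟨τ, η, hη, hne, hle.trans hlt.le, hk⟩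

theorem Run.le_card_mul_card [Fintype X] (hE : E.IsMaxMorcave)
    {P : E.MaxStrat → (X → EReal) → E.MaxStrat} (hP : E.IsImprovementOperator P)
    {σinit : E.MaxStrat} (hinit : ∀ x, E.applyStrat σinit x = FixExpr.negInf)
    {n : ℕ} {σ : E.MaxStrat} {ρ : X → EReal} (hrun : E.Run P σinit (fun _ => ⊥) n σ ρ) :
    n ≤ Fintype.card X * Nat.card E.MaxStrat := by
  obtain ⟨-, V, rfl, hkeys⟩ := hrun.invariant hE hP hinit
  let := Fintype.ofFinite E.MaxStrat
  have hsub : V ⊆ Finset.range (Fintype.card X) ×ˢ Finset.univ := by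
    intro k hk
    obtain ⟨τ, η, -, hne, -, rfl⟩ := hkeys k hk
    simpa using stepKey_fst_lt σinit τ hne
  simpa [Nat.card_eq_fintype_card] using Finset.card_le_card hsub

/-- As long as no solution is found, the loop body can be evaluated. -/
theorem exists_returns_or_run [Fintype X] (hE : E.IsMaxMorcave)
    {P : E.MaxStrat → (X → EReal) → E.MaxStrat} (hP : E.IsImprovementOperator P)
    {σinit : E.MaxStrat} (hinit : ∀ x, E.applyStrat σinit x = FixExpr.negInf) (n : ℕ) :
    (∃ m ρ, E.Returns P σinit (fun _ => ⊥) m ρ) ∨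
      ∃ σ ρ, E.Run P σinit (fun _ => ⊥) n σ ρ := by
  induction n with
  | zero => exact .inr ⟨_, _, .init⟩
  | succ n ih =>
    rcases ih with h | ⟨σ, ρ, hrun⟩
    · exact .inl h
    by_cases hsol : ρ ∈ E.sol
    · exact .inl ⟨n, ρ, σ, hrun, hsol⟩
    have himp := hP σ ρ (hrun.invariant hE hP hinit).1.mem_preSol
    obtain ⟨m, hm, -⟩ := exists_isLeast_sol hE (himp.1 hsol).le
    exact .inr ⟨_, m, hrun.step hsol hm⟩

end EqSystem

theorem mainTheorem1 {X : Type*} [Fintype X] (E : EqSystem X)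
    (hmorcave : E.IsMaxMorcave) (hstandard : E.IsStandard)
    (P : E.MaxStrat → (X → EReal) → E.MaxStrat) (hP : E.IsImprovementOperator P)
    (σinit : E.MaxStrat) (hinit : ∀ x, E.applyStrat σinit x = FixExpr.negInf) :
    (∃ μ : X → EReal, IsLeast E.sol μ ∧
      ∃ n ≤ Fintype.card X * Nat.card E.MaxStrat,
        E.Returns P σinit (fun _ => ⊥) n μ) ∧
    ∀ (n : ℕ) (σ : E.MaxStrat) (ρ : X → EReal), E.Run P σinit (fun _ => ⊥) n σ ρ →
      n ≤ Fintype.card X * Nat.card E.MaxStrat := by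
  have hbound := fun (n : ℕ) (σ : E.MaxStrat) (ρ : X → EReal)
    (hrun : E.Run P σinit (fun _ => ⊥) n σ ρ) => hrun.le_card_mul_card hmorcave hP hinit
  refine ⟨?_, hbound⟩
  rcases EqSystem.exists_returns_or_run hmorcave hP hinit
    (Fintype.card X * Nat.card E.MaxStrat + 1) with ⟨n, μ, σ, hrun, hsol⟩ | ⟨σ, ρ, hrun⟩
  · exact ⟨μ, ⟨hsol, (hrun.invariant hmorcave hP hinit).1.le_sol⟩, n, hbound n σ μ hrun, σ, hrun,
      hsol⟩
  · exact absurd (hbound _ _ _ hrun) (Nat.not_succ_le_self _)
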